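/- Let $M$ be a smooth manifold (finite-dimensional, Hausdorff, second countable, without boundary), $T^{\mathbb C}M=TM\otimes_{\mathbb R}\mathbb C$. A *special complex structure* on $M$ is a pair $(I,\nabla)$ of an (integrable) complex structure $I$ on $M$ and a flat torsion-free linear connection $\nabla$ on $TM$ with $d_\nabla I=0$, i.e. $\nabla_X(IY)-\nabla_Y(IX)-I[X,Y]=0$ for all vector fields $X,Y$. A *special Kähler structure* is a triple $(I,\nabla,\omega)$ with $(I,\nabla)$ special complex, $\omega$ a Kähler form for $I$ (closed, $I$-invariant, with $g(u,v)=\omega(u,Iv)$ positive definite) and $\nabla\omega=0$. A *variation of Hodge structure (VHS) of weight $1$ on $T^{\mathbb C}M$* consists of a complex structure $I$ on $M$, a flat complex linear connection $D$ on $T^{\mathbb C}M$ which preserves the real subbundle $TM$ and is torsion-free, and a decreasing filtration $T^{\mathbb C}M=\mathcal F^0\supseteq\mathcal F^1\supseteq\mathcal F^2=0$ by subbundles that are holomorphic for the holomorphic structure $D^{0,1}$ (that is, smooth subbundles with $D_{\overline Y}\Gamma(\mathcal F^k)\subseteq\Gamma(\mathcal F^k)$ for all $Y\in\Gamma(T^{1,0})$),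 satisfying $D\,\Gamma(\mathcal F^k)\subseteq\Gamma(\mathcal F^{k-1}\otimes T^*M)$, inducing on every fibre a Hodge structure of weight $1$, $T^{\mathbb C}_xM=\mathcal F^1_x\oplus\overline{\mathcal F^1_x}$, and with $\mathcal F^1=T^{1,0}$, the $(1,0)$-tangent bundle of $(M,I)$. A *variation of polarized Hodge structures (VPHS) of weight $1$ on $T^{\mathbb C}M$* is such a VHS with a smooth $D$-flat antisymmetric $\mathbb C$-bilinear form $Q$ on $T^{\mathbb C}M$, real on $TM$, such that for the Hodge decomposition $V^{1,0}=\mathcal F^1$, $V^{0,1}=\overline{\mathcal F^1}$ one has $Q(V^{k,l},V^{r,s})=0$ unless $(k,l)=(s,r)$, and $(\sqrt{-1})^{k-l}Q(x,\bar x)>0$ for $0\ne x\in V^{k,l}$. **Theorem.** For every special complex structure $(I,\nabla)$ on $M$, the subbundle $T^{1,0}$ is a $\nabla^{0,1}$-holomorphic subbundle of $T^{\mathbb C}M$, and $$(I,\nabla)\longmapsto\bigl(I,\ \nabla^{\mathbb C},\ T^{\mathbb C}M\supseteq T^{1,0}\supseteq 0\bigr),$$ where $\nabla^{\mathbb C}$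 is the $\mathbb C$-linear extension of $\nabla$, is a bijection from the set of special complex structures on $M$ onto the set of VHS of weight $1$ on $T^{\mathbb C}M$. It extends to a bijection from the set of special Kähler structures on $M$ onto the set of VPHS of weight $1$ on $T^{\mathbb C}M$: the image of $(I,\nabla,\omega)$ has the image of $(I,\nabla)$ as its underlying VHS, and its polarization $Q$ satisfies $Q|_{TM}=-\omega$. -/

import Mathlib

open scoped Manifold ContDiff TensorProduct Topology

noncomputable section

namespace SpecialGeometry

/-! ### Complexification of a real vector space -/

/-- Complex conjugation on the complexification `ℂ ⊗ V` of a real vector space `V`. -/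
def conjC (V : Type*) [AddCommGroup V] [Module ℝ V] :
    ℂ ⊗[ℝ] V →ₛₗ[starRingEnd ℂ] ℂ ⊗[ℝ] V where
  toFun z := LinearMap.rTensor V Complex.conjAe.toLinearMap z
  map_add' z w := map_add _ z w
  map_smul' c z := by
    induction z using TensorProduct.induction_on with
    | zero => simp
    | tmul a v => simp [TensorProduct.smul_tmul']
    | add z w hz hw => rw [smul_add, map_add, hz, hw, map_add, smul_add]

/-! ### Smooth vector fields, real and complex -/

section VectorFields

variable (E : Type*) [NormedAddCommGroup E] [NormedSpace ℝ E]
  (M : Type*) [TopologicalSpace M] [ChartedSpace E M] [IsManifold 𝓘(ℝ, E) ∞ M]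

/-- Smooth real-valued functions on `M`. -/
abbrev SmoothFun : Type _ := C^∞⟮𝓘(ℝ, E), M; 𝓘(ℝ, ℝ), ℝ⟯

/-- Smooth sections of the real tangent bundle `TM`. -/
abbrev VField : Type _ := Cₛ^∞⟮𝓘(ℝ, E); E, (TangentSpace 𝓘(ℝ, E) : M → Type _)⟯

/-- Smooth sections of the complexified tangent bundle `T^ℂ M`: formal sums `X + iY` of smooth real
vector fields `X`, `Y`, that is, `ℂ ⊗ Γ(TM)`. -/
abbrev CField : Type _ := ℂ ⊗[ℝ] VField E M

variable {M}

/-- The fibre at `x` of the complexified tangent bundle `T^ℂ M`. -/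
abbrev CTangent (x : M) : Type _ := ℂ ⊗[ℝ] TangentSpace 𝓘(ℝ, E) x

variable {E}

/-- The value of a vector field at a point. -/
def VField.evalAt (x : M) : VField E M →ₗ[ℝ] TangentSpace 𝓘(ℝ, E) x where
  toFun X := X x
  map_add' _ _ := rfl
  map_smul' _ _ := rfl

/-- The value of a complex vector field at a point. -/
def CField.evalAt (x : M) : CField E M →ₗ[ℂ] CTangent E x :=
  (VField.evalAt x).baseChange ℂ

/-- Multiplication of vector fields by a smooth function. -/
def VField.mulFun (f : SmoothFun E M) : VField E M →ₗ[ℝ] VField E M where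
  toFun X := ⟨fun x => f x • X x, f.contMDiff.smul_section X.contMDiff⟩
  map_add' X Y := by ext x; exact smul_add (f x) (X x) (Y x)
  map_smul' c X := by ext x; exact smul_comm (f x) c (X x)

/-- Multiplication of complex vector fields by a smooth real function. -/
def CField.mulFun (f : SmoothFun E M) : CField E M →ₗ[ℂ] CField E M :=
  (VField.mulFun f).baseChange ℂ

/-- A real vector field, seen as a complex one. -/
def VField.toC (X : VField E M) : CField E M := (1 : ℂ) ⊗ₜ[ℝ] X

/-- A real tangent vector, seen as a complex one. -/
def toCTangent {x : M} (v : TangentSpace 𝓘(ℝ, E) x) : CTangent E x := (1 : ℂ) ⊗ₜ[ℝ] v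

/-- The derivative at `x` of a function `g` in the direction of the vector field `X`. -/
def dirDeriv {G : Type*} [NormedAddCommGroup G] [NormedSpace ℝ G] (X : VField E M) (g : M → G)
    (x : M) : G :=
  mvfderiv 𝓘(ℝ, E) g x (X x)

/-- The Lie bracket `[X, Y]` of smooth vector fields. -/
def VField.bracket [FiniteDimensional ℝ E] (X Y : VField E M) : VField E M :=
  ⟨fun x => VectorField.mlieBracket 𝓘(ℝ, E) (fun y => X y) (fun y => Y y) x, by
    have : CompleteSpace E := FiniteDimensional.complete ℝ E
    have h2 : IsManifold 𝓘(ℝ, E) (minSmoothness ℝ 2) M := IsManifold.of_le (n := ∞) (by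
      rw [minSmoothness_of_isRCLikeNormedField]; exact WithTop.coe_le_coe.2 le_top)
    have h1 : IsManifold 𝓘(ℝ, E) (((⊤ : ℕ∞) : WithTop ℕ∞) + 1) M :=
      inferInstanceAs (IsManifold 𝓘(ℝ, E) ∞ M)
    exact ContDiff.mlieBracket_vectorField (m := ⊤) (n := ⊤) X.contMDiff Y.contMDiff (by simp)⟩

end VectorFields

variable (E : Type*) [NormedAddCommGroup E] [NormedSpace ℝ E] [FiniteDimensional ℝ E]
  (M : Type*) [TopologicalSpace M] [ChartedSpace E M] [IsManifold 𝓘(ℝ, E) ∞ M]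

/-! ### Complex structures -/

/-- A smooth almost complex structure on `M`. -/
@[ext]
structure AlmostComplexStructure where
  J : ∀ x : M, TangentSpace 𝓘(ℝ, E) x →ₗ[ℝ] TangentSpace 𝓘(ℝ, E) x
  sq : ∀ (x : M) (v : TangentSpace 𝓘(ℝ, E) x), J x (J x v) = -v
  smooth : ∀ X : VField E M, ContMDiff 𝓘(ℝ, E) 𝓘(ℝ, E).tangent ∞
    (fun x => (⟨x, J x (X x)⟩ : TangentBundle 𝓘(ℝ, E) M))

/-- A complex structure on `M`: around each point there are smooth coordinates with values in some
`ℂⁿ` whose differentials intertwine `J` with the multiplication by `i`. -/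
@[ext]
structure ComplexStructure extends AlmostComplexStructure E M where
  integrable : ∀ x : M, ∃ (n : ℕ) (φ : OpenPartialHomeomorph M (Fin n → ℂ)), x ∈ φ.source ∧
    ContMDiffOn 𝓘(ℝ, E) 𝓘(ℝ, Fin n → ℂ) ∞ φ φ.source ∧
    ContMDiffOn 𝓘(ℝ, Fin n → ℂ) 𝓘(ℝ, E) ∞ φ.symm φ.target ∧
    ∀ y ∈ φ.source, ∀ v : TangentSpace 𝓘(ℝ, E) y,
      mvfderiv 𝓘(ℝ, E) φ y (J y v) = Complex.I • mvfderiv 𝓘(ℝ, E) φ y v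

variable {E M}

/-- The vector field `IX`. -/
def AlmostComplexStructure.app (I : AlmostComplexStructure E M) (X : VField E M) : VField E M :=
  ⟨fun x => I.J x (X x), I.smooth X⟩

/-- The fibre at `x` of the holomorphic tangent bundle `T^{1,0} ⊆ T^ℂ M`. -/
def AlmostComplexStructure.T10 (I : AlmostComplexStructure E M) (x : M) :
    Submodule ℂ (CTangent E x) :=
  Module.End.eigenspace ((I.J x).baseChange ℂ) Complex.I

variable (E M)

/-! ### Connections on `TM`, special complex and special Kähler structures -/

/-- A smooth linear connection `∇` on the real tangent bundle; `nabla X Y` is `∇_X Y`. -/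
@[ext]
structure LinearConnection where
  nabla : VField E M →ₗ[ℝ] VField E M →ₗ[ℝ] VField E M
  smul_left : ∀ (f : SmoothFun E M) (X Y : VField E M),
    nabla (VField.mulFun f X) Y = VField.mulFun f (nabla X Y)
  leibniz : ∀ (f : SmoothFun E M) (X Y : VField E M) (x : M),
    nabla X (VField.mulFun f Y) x = f x • nabla X Y x + dirDeriv X f x • Y x

variable {E M}

def LinearConnection.IsFlat (C : LinearConnection E M) : Prop :=
  ∀ X Y Z : VField E M,
    C.nabla X (C.nabla Y Z) - C.nabla Y (C.nabla X Z) - C.nabla (X.bracket Y) Z = 0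

def LinearConnection.IsTorsionFree (C : LinearConnection E M) : Prop :=
  ∀ X Y : VField E M, C.nabla X Y - C.nabla Y X - X.bracket Y = 0

/-- The exterior covariant derivative `d_∇ I` of `I`, regarded as a `TM`-valued `1`-form. -/
def LinearConnection.dNabla (C : LinearConnection E M) (I : AlmostComplexStructure E M)
    (X Y : VField E M) : VField E M :=
  C.nabla X (I.app Y) - C.nabla Y (I.app X) - I.app (X.bracket Y)

variable (E M)

/-- A special complex structure `(I, ∇)` on `M`. -/
@[ext]
structure SpecialComplexStructure where
  I : ComplexStructure E M
  conn : LinearConnection E M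
  flat : conn.IsFlat
  torsionFree : conn.IsTorsionFree
  dNabla_eq_zero : ∀ X Y : VField E M, conn.dNabla I.toAlmostComplexStructure X Y = 0

/-- A smooth real differential `2`-form on `M`. -/
@[ext]
structure TwoForm where
  form : ∀ x : M, TangentSpace 𝓘(ℝ, E) x →ₗ[ℝ] TangentSpace 𝓘(ℝ, E) x →ₗ[ℝ] ℝ
  alt : ∀ (x : M) (v : TangentSpace 𝓘(ℝ, E) x), form x v v = 0
  smooth : ∀ X Y : VField E M, ContMDiff 𝓘(ℝ, E) 𝓘(ℝ, ℝ) ∞ (fun x => form x (X x) (Y x))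

variable {E M}

/-- The function `Ω(X, Y)`. -/
def TwoForm.app (Ω : TwoForm E M) (X Y : VField E M) (x : M) : ℝ := Ω.form x (X x) (Y x)

/-- `dΩ = 0`, with the exterior derivative evaluated on vector fields. -/
def TwoForm.IsClosed (Ω : TwoForm E M) : Prop :=
  ∀ (X Y Z : VField E M) (x : M),
    dirDeriv X (Ω.app Y Z) x - dirDeriv Y (Ω.app X Z) x + dirDeriv Z (Ω.app X Y) x
      - Ω.app (X.bracket Y) Z x + Ω.app (X.bracket Z) Y x - Ω.app (Y.bracket Z) X x = 0

/-- `Ω` is a Kähler form for `I`: it is closed, `I`-invariant, and `g(u, v) = Ω(u, Iv)` is positive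
definite. -/
structure TwoForm.IsKahler (Ω : TwoForm E M) (I : AlmostComplexStructure E M) : Prop where
  closed : Ω.IsClosed
  invariant : ∀ (x : M) (u v : TangentSpace 𝓘(ℝ, E) x),
    Ω.form x (I.J x u) (I.J x v) = Ω.form x u v
  pos : ∀ (x : M) (u : TangentSpace 𝓘(ℝ, E) x), u ≠ 0 → 0 < Ω.form x u (I.J x u)

/-- `∇Ω = 0`. -/
def TwoForm.IsParallel (Ω : TwoForm E M) (C : LinearConnection E M) : Prop :=
  ∀ (X Y Z : VField E M) (x : M),
    dirDeriv X (Ω.app Y Z) x - Ω.app (C.nabla X Y) Z x - Ω.app Y (C.nabla X Z) x = 0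

variable (E M)

/-- A special Kähler structure `(I, ∇, Ω)` on `M`. -/
@[ext]
structure SpecialKahlerStructure extends SpecialComplexStructure E M where
  Ω : TwoForm E M
  kahler : Ω.IsKahler I.toAlmostComplexStructure
  parallel : Ω.IsParallel conn

/-! ### Connections and subbundles on `T^ℂ M` -/

/-- A smooth complex linear connection `D` on the complex vector bundle `T^ℂ M`. -/
@[ext]
structure ComplexConnection where
  nabla : VField E M →ₗ[ℝ] (CField E M →ₗ[ℂ] CField E M)
  smul_left : ∀ (f : SmoothFun E M) (X : VField E M) (Z : CField E M),
    nabla (VField.mulFun f X) Z = CField.mulFun f (nabla X Z)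
  leibniz : ∀ (f : SmoothFun E M) (X : VField E M) (Z : CField E M) (x : M),
    CField.evalAt x (nabla X (CField.mulFun f Z)) =
      f x • CField.evalAt x (nabla X Z) + dirDeriv X f x • CField.evalAt x Z

variable {E M}

/-- `D_W Z` for a complex vector field `W`, by `ℂ`-linear extension. -/
def ComplexConnection.nablaC (D : ComplexConnection E M) :
    CField E M →ₗ[ℂ] (CField E M →ₗ[ℂ] CField E M) :=
  D.nabla.liftBaseChange ℂ

def ComplexConnection.IsFlat (D : ComplexConnection E M) : Prop :=
  ∀ (X Y : VField E M) (Z : CField E M),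
    D.nabla X (D.nabla Y Z) - D.nabla Y (D.nabla X Z) - D.nabla (X.bracket Y) Z = 0

/-- `TM ⊆ T^ℂ M` is a flat real subbundle: `D` maps sections of `TM` to sections of `TM`. -/
def ComplexConnection.IsReal (D : ComplexConnection E M) : Prop :=
  ∀ X Y : VField E M, ∃ W : VField E M, D.nabla X Y.toC = W.toC

def ComplexConnection.IsTorsionFree (D : ComplexConnection E M) : Prop :=
  ∀ X Y : VField E M, D.nabla X Y.toC - D.nabla Y X.toC - (X.bracket Y).toC = 0

/-- `Z` is a section of the family of subspaces `F`. -/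
def IsSectionOf (F : ∀ x : M, Submodule ℂ (CTangent E x)) (Z : CField E M) : Prop :=
  ∀ x : M, CField.evalAt x Z ∈ F x

/-- `F` is a smooth complex subbundle of `T^ℂ M`: it has smooth local frames. -/
def IsSmoothSubbundle (F : ∀ x : M, Submodule ℂ (CTangent E x)) : Prop :=
  ∀ x : M, ∃ (r : ℕ) (s : Fin r → CField E M), ∀ᶠ y in 𝓝 x,
    LinearIndependent ℂ (fun i => CField.evalAt y (s i)) ∧
      Submodule.span ℂ (Set.range fun i => CField.evalAt y (s i)) = F y

/-- `F` is a holomorphic subbundle of `T^ℂ M` with the holomorphic structure given by `D^{0,1}`: it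
is a smooth subbundle, and `D_{\bar Y}` preserves its sections for every `Y` of type `(1,0)`. -/
def IsHolomorphicSubbundle (I : AlmostComplexStructure E M) (D : ComplexConnection E M)
    (F : ∀ x : M, Submodule ℂ (CTangent E x)) : Prop :=
  IsSmoothSubbundle F ∧
    ∀ Y Z : CField E M, IsSectionOf I.T10 Y → IsSectionOf F Z →
      IsSectionOf F (D.nablaC (conjC _ Y) Z)

variable (E M)

/-! ### Variations of Hodge structure on `T^ℂ M` -/

/-- A (real) variation of Hodge structure of weight `p` on `T^ℂ M`. The base is `M` with the complex
structure `I`, the real structure is `TM ⊆ T^ℂ M`, and `F` is the decreasing Hodge filtration by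
`D^{0,1}`-holomorphic subbundles. -/
@[ext]
structure VHS (p : ℕ) where
  I : ComplexStructure E M
  D : ComplexConnection E M
  flat : D.IsFlat
  real : D.IsReal
  F : ℤ → ∀ x : M, Submodule ℂ (CTangent E x)
  antitone : ∀ (k l : ℤ) (x : M), k ≤ l → F l x ≤ F k x
  F_nonpos : ∀ (k : ℤ) (x : M), k ≤ 0 → F k x = ⊤
  holomorphic : ∀ k : ℤ, IsHolomorphicSubbundle I.toAlmostComplexStructure D (F k)
  transversal : ∀ (k : ℤ) (X : VField E M) (Z : CField E M),
    IsSectionOf (F k) Z → IsSectionOf (F (k - 1)) (D.nabla X Z)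
  hodge : ∀ (k : ℤ) (x : M), IsCompl (F k x) ((F (p - k + 1) x).map (conjC _))

variable {E M}

/-- The summand `V^{k, p-k}` at `x` of the Hodge decomposition: `F^k ∩ \bar{F^{p-k}}`. -/
def VHS.piece {p : ℕ} (V : VHS E M p) (k : ℤ) (x : M) : Submodule ℂ (CTangent E x) :=
  V.F k x ⊓ (V.F (p - k) x).map (conjC _)

variable (E M)

/-- A (real) variation of polarized Hodge structures of weight `p` on `T^ℂ M`, with polarization
`Q` (automatically nondegenerate, by `Q_orth` and `Q_pos`). -/
@[ext]
structure VPHS (p : ℕ) extends VHS E M p where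
  Q : ∀ x : M, CTangent E x →ₗ[ℂ] CTangent E x →ₗ[ℂ] ℂ
  Q_smooth : ∀ Z W : CField E M, ContMDiff 𝓘(ℝ, E) 𝓘(ℝ, ℂ) ∞
    (fun x => Q x (CField.evalAt x Z) (CField.evalAt x W))
  Q_symm : ∀ (x : M) (z w : CTangent E x), Q x z w = (-1) ^ p * Q x w z
  Q_real : ∀ (x : M) (u v : TangentSpace 𝓘(ℝ, E) x),
    (Q x (toCTangent u) (toCTangent v)).im = 0
  Q_flat : ∀ (X : VField E M) (Z W : CField E M) (x : M),
    dirDeriv X (fun y => Q y (CField.evalAt y Z) (CField.evalAt y W)) x =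
      Q x (CField.evalAt x (D.nabla X Z)) (CField.evalAt x W) +
        Q x (CField.evalAt x Z) (CField.evalAt x (D.nabla X W))
  Q_orth : ∀ (k l : ℤ) (x : M), k + l ≠ p →
    ∀ z ∈ toVHS.piece k x, ∀ w ∈ toVHS.piece l x, Q x z w = 0
  Q_pos : ∀ (k : ℤ) (x : M), ∀ z ∈ toVHS.piece k x, z ≠ 0 →
    ∃ r : ℝ, 0 < r ∧ Complex.I ^ (k - (p - k)) * Q x z (conjC _ z) = r

variable {E M}

/-- The compatibility of a weight-one variation on the bundle `T^ℂ M` with this bundle being the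
complexified tangent bundle of its own base: the connection is torsion free, and the `(1,0)`-part
`F¹` of the Hodge decomposition is the `(1,0)`-tangent bundle of the complex structure of `M`. -/
structure VHS.IsTangential (V : VHS E M 1) : Prop where
  torsionFree : V.D.IsTorsionFree
  F_one : ∀ x : M, V.F 1 x = V.I.T10 x

variable (E M)

/-- Variations of Hodge structure of weight one on `T^ℂ M`. -/
def TangentVHS : Type _ := {V : VHS E M 1 // V.IsTangential}

/-- Variations of polarized Hodge structures of weight one on `T^ℂ M`. -/
def TangentVPHS : Type _ := {V : VPHS E M 1 // V.toVHS.IsTangential}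

variable {E M}

/-- Forgetting the polarization. -/
def TangentVPHS.toTangentVHS (V : TangentVPHS E M) : TangentVHS E M := ⟨V.1.toVHS, V.2⟩

end SpecialGeometry

end

/-! A complex connection that preserves `TM` is the same thing as its restriction to `TM`, and
flatness and torsion pass both ways. In weight one the filtration is forced by `F 1 = T10`: the
Hodge condition kills `F k` for `k ≥ 2`, and transversality is automatic. What remains is to see
that, for a torsion-free connection and an integrable `I`, the condition d_∇ I = 0 is equivalent to
D^{0,1} preserving T^{1,0}.

The failure of D_{X+iIX}(Y-iIY) to be of type (1,0) is recorded by the real expression `dbar`, which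
equals -(∇_X I)Y + I(∇_{IX} I)Y. If d_∇ I = 0, then (∇_X I)Y is symmetric in X and Y, and this
symmetry makes `dbar` vanish (`dbar_eq_zero_of_dNabla`). Conversely, antisymmetrising `dbar` gives I
N(X,Y) - 2 d_∇ I(X,Y), where N is the Nijenhuis tensor (`dNabla_eq_zero_of_dbar`). N vanishes
because `I` is constant in holomorphic charts (`nijenhuis_eq_zero`).

For polarizations, Q is the complex-bilinear extension of -ω. Parallelism of ω is flatness of Q,
invariance under `I` is the vanishing of Q on pairs of equal type, and iQ(z, z̄) = 2ω(u, Iu) for z =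
u - iIu. Closedness follows from parallelism, since the connection has no torsion. -/

noncomputable section

namespace SpecialGeometry

/-! ### Real and imaginary parts in a complexification -/

section Complexification

variable {V W : Type*} [AddCommGroup V] [Module ℝ V] [AddCommGroup W] [Module ℝ W]

/-- The real part of an element of `ℂ ⊗ V`. -/
def rePart : ℂ ⊗[ℝ] V →ₗ[ℝ] V :=
  (TensorProduct.lid ℝ V).toLinearMap ∘ₗ LinearMap.rTensor V Complex.reLm

/-- The imaginary part of an element of `ℂ ⊗ V`. -/
def imPart : ℂ ⊗[ℝ] V →ₗ[ℝ] V :=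
  (TensorProduct.lid ℝ V).toLinearMap ∘ₗ LinearMap.rTensor V Complex.imLm

@[simp] lemma rePart_tmul (c : ℂ) (v : V) : rePart (c ⊗ₜ[ℝ] v) = c.re • v := by
  simp [rePart]

@[simp] lemma imPart_tmul (c : ℂ) (v : V) : imPart (c ⊗ₜ[ℝ] v) = c.im • v := by
  simp [imPart]

lemma eq_rePart_add_imPart (z : ℂ ⊗[ℝ] V) :
    z = (1 : ℂ) ⊗ₜ[ℝ] rePart z + Complex.I ⊗ₜ[ℝ] imPart z := by
  induction z using TensorProduct.induction_on with
  | zero => simp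
  | tmul c v =>
    rw [rePart_tmul, imPart_tmul, TensorProduct.tmul_smul, TensorProduct.tmul_smul,
      TensorProduct.smul_tmul', TensorProduct.smul_tmul', ← TensorProduct.add_tmul]
    congr 1
    apply Complex.ext <;> simp
  | add z w hz hw =>
    conv_lhs => rw [hz, hw]
    simp only [map_add, TensorProduct.tmul_add]
    abel

/-- This splits an identity in a complexification into two real ones, which the simp lemmas on
`rePart` and `imPart` then compute. -/
lemma ext_re_im {z w : ℂ ⊗[ℝ] V} (hr : rePart z = rePart w) (hi : imPart z = imPart w) :
    z = w := by
  rw [eq_rePart_add_imPart z, eq_rePart_add_imPart w, hr, hi]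

@[simp] lemma rePart_smul (c : ℂ) (z : ℂ ⊗[ℝ] V) :
    rePart (c • z) = c.re • rePart z - c.im • imPart z := by
  induction z using TensorProduct.induction_on with
  | zero => simp
  | tmul d v => simp [TensorProduct.smul_tmul', sub_smul, mul_smul]
  | add z w hz hw => simp only [smul_add, map_add, hz, hw]; abel

@[simp] lemma imPart_smul (c : ℂ) (z : ℂ ⊗[ℝ] V) :
    imPart (c • z) = c.re • imPart z + c.im • rePart z := by
  induction z using TensorProduct.induction_on with
  | zero => simp
  | tmul d v => simp [TensorProduct.smul_tmul', add_smul, mul_smul]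
  | add z w hz hw => simp only [smul_add, map_add, hz, hw]; abel

@[simp] lemma rePart_baseChange (f : V →ₗ[ℝ] W) (z : ℂ ⊗[ℝ] V) :
    rePart (f.baseChange ℂ z) = f (rePart z) := by
  induction z using TensorProduct.induction_on with
  | zero => simp
  | tmul d v => simp
  | add z w hz hw => simp only [map_add, hz, hw]

@[simp] lemma imPart_baseChange (f : V →ₗ[ℝ] W) (z : ℂ ⊗[ℝ] V) :
    imPart (f.baseChange ℂ z) = f (imPart z) := by
  induction z using TensorProduct.induction_on with
  | zero => simp
  | tmul d v => simp
  | add z w hz hw => simp only [map_add, hz, hw]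

@[simp] lemma rePart_conjC (z : ℂ ⊗[ℝ] V) : rePart (conjC V z) = rePart z := by
  induction z using TensorProduct.induction_on with
  | zero => simp
  | tmul d v => simp [conjC]
  | add z w hz hw => simp only [map_add, hz, hw]

@[simp] lemma imPart_conjC (z : ℂ ⊗[ℝ] V) : imPart (conjC V z) = -imPart z := by
  induction z using TensorProduct.induction_on with
  | zero => simp
  | tmul d v => simp [conjC]
  | add z w hz hw => simp only [map_add, hz, hw]; abel

@[simp] lemma conjC_conjC (z : ℂ ⊗[ℝ] V) : conjC V (conjC V z) = z :=
  ext_re_im (by simp) (by simp)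

lemma mem_map_conjC {F : Submodule ℂ (ℂ ⊗[ℝ] V)} {z : ℂ ⊗[ℝ] V} :
    z ∈ F.map (conjC V) ↔ conjC V z ∈ F := by
  refine ⟨?_, fun h => ⟨_, h, conjC_conjC z⟩⟩
  rintro ⟨w, hw, rfl⟩
  simpa using hw

lemma map_conjC_top : (⊤ : Submodule ℂ (ℂ ⊗[ℝ] V)).map (conjC V) = ⊤ :=
  eq_top_iff.2 fun _ _ => mem_map_conjC.2 trivial

end Complexification

/-! ### Complex vector fields through their real and imaginary parts -/

section ComplexFields

variable {E : Type*} [NormedAddCommGroup E] [NormedSpace ℝ E]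
  {M : Type*} [TopologicalSpace M] [ChartedSpace E M]

@[simp] lemma rePart_toCTangent {x : M} (v : TangentSpace 𝓘(ℝ, E) x) :
    rePart (toCTangent v) = v := by simp [toCTangent]
@[simp] lemma imPart_toCTangent {x : M} (v : TangentSpace 𝓘(ℝ, E) x) :
    imPart (toCTangent v) = 0 := by simp [toCTangent]

variable [IsManifold 𝓘(ℝ, E) ∞ M]

section Fields

@[simp] lemma VField.sub_apply (X Y : VField E M) (x : M) : (X - Y) x = X x - Y x := rfl

@[simp] lemma VField.zero_apply (x : M) : (0 : VField E M) x = 0 := rfl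

@[simp] lemma VField.evalAt_apply (X : VField E M) (x : M) : VField.evalAt x X = X x := rfl

@[simp] lemma rePart_evalAt (x : M) (Z : CField E M) :
    rePart (CField.evalAt x Z) = rePart Z x := by
  simp [CField.evalAt]

@[simp] lemma imPart_evalAt (x : M) (Z : CField E M) :
    imPart (CField.evalAt x Z) = imPart Z x := by
  simp [CField.evalAt]

@[simp] lemma rePart_mulFun (f : SmoothFun E M) (Z : CField E M) :
    rePart (CField.mulFun f Z) = VField.mulFun f (rePart Z) := by
  simp [CField.mulFun]

@[simp] lemma imPart_mulFun (f : SmoothFun E M) (Z : CField E M) :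
    imPart (CField.mulFun f Z) = VField.mulFun f (imPart Z) := by
  simp [CField.mulFun]

@[simp] lemma rePart_toC (X : VField E M) : rePart X.toC = X := by simp [VField.toC]
@[simp] lemma imPart_toC (X : VField E M) : imPart X.toC = 0 := by simp [VField.toC]

@[simp] lemma evalAt_toC (x : M) (X : VField E M) :
    CField.evalAt x X.toC = toCTangent (X x) := ext_re_im (by simp) (by simp)

end Fields

/-! ### Connections on `TM` and real connections on the complexified tangent bundle -/

section Connections

/-- The complex-linear extension of a connection on `TM` to `T^ℂ M`. -/
def LinearConnection.complexify (C : LinearConnection E M) : ComplexConnection E M where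
  nabla := LinearMap.baseChangeHom ℝ ℂ _ _ ∘ₗ C.nabla
  smul_left f X Z := by
    apply ext_re_im <;> simp [C.smul_left]
  leibniz f X Z x := by
    apply ext_re_im <;> simp [C.leibniz]

variable (C : LinearConnection E M) (D : ComplexConnection E M)

@[simp] lemma rePart_complexify (X : VField E M) (Z : CField E M) :
    rePart (C.complexify.nabla X Z) = C.nabla X (rePart Z) := by
  simp [LinearConnection.complexify]

@[simp] lemma imPart_complexify (X : VField E M) (Z : CField E M) :
    imPart (C.complexify.nabla X Z) = C.nabla X (imPart Z) := by
  simp [LinearConnection.complexify]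

lemma complexify_toC (X Y : VField E M) :
    C.complexify.nabla X Y.toC = (C.nabla X Y).toC :=
  ext_re_im (by simp) (by simp)

lemma complexify_isReal : C.complexify.IsReal := fun X Y => ⟨_, complexify_toC C X Y⟩

lemma nablaC_eq (W Z : CField E M) :
    D.nablaC W Z = D.nabla (rePart W) Z + Complex.I • D.nabla (imPart W) Z := by
  conv_lhs => rw [eq_rePart_add_imPart W]
  simp [ComplexConnection.nablaC]

@[simp] lemma rePart_nablaC_complexify (W Z : CField E M) :
    rePart (C.complexify.nablaC W Z) =
      C.nabla (rePart W) (rePart Z) - C.nabla (imPart W) (imPart Z) := by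
  simp [nablaC_eq, sub_eq_add_neg]

@[simp] lemma imPart_nablaC_complexify (W Z : CField E M) :
    imPart (C.complexify.nablaC W Z) =
      C.nabla (rePart W) (imPart Z) + C.nabla (imPart W) (rePart Z) := by
  simp [nablaC_eq]

lemma toC_add (X Y : VField E M) : (X + Y).toC = X.toC + Y.toC :=
  ext_re_im (by simp) (by simp)

lemma toC_injective : Function.Injective (VField.toC : VField E M → CField E M) := fun X Y h => by
  simpa using congrArg rePart h

/-- The restriction to `TM` of a real connection on `T^ℂ M`. -/
def ComplexConnection.restrict (_hD : D.IsReal) : LinearConnection E M where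
  nabla := LinearMap.mk₂ ℝ (fun X Y => rePart (D.nabla X Y.toC)) (by simp) (by simp)
    (fun X Y Z => by rw [toC_add, map_add, map_add])
    (fun c X Y => by
      have h : (c • Y).toC = (c : ℂ) • Y.toC := 
        ext_re_im (by rw [rePart_smul]; simp) (by rw [imPart_smul]; simp)
      rw [h, map_smul, rePart_smul]; simp)
  smul_left f X Y := by simp [D.smul_left]
  leibniz f X Y x := by
    have h : (VField.mulFun f Y).toC = CField.mulFun f Y.toC := ext_re_im (by simp) (by simp)
    have := congrArg rePart (D.leibniz f X Y.toC x)
    rw [← h] at this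
    simpa using this

lemma restrict_nabla (hD : D.IsReal) (X Y : VField E M) :
    (D.restrict hD).nabla X Y = rePart (D.nabla X Y.toC) := rfl

/-- Reality of `D` is what ensures that taking the real part in `restrict` loses nothing. -/
lemma restrict_nabla_toC (hD : D.IsReal) (X Y : VField E M) :
    ((D.restrict hD).nabla X Y).toC = D.nabla X Y.toC := by
  obtain ⟨W, hW⟩ := hD X Y
  rw [restrict_nabla, hW, rePart_toC]

/-- Real fields generate the complex ones over ℂ, and connections are ℂ-linear in the differentiated
field. -/
lemma complexConnection_ext_toC {D D' : ComplexConnection E M}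
    (h : ∀ X Y : VField E M, D.nabla X Y.toC = D'.nabla X Y.toC) : D = D' := by
  refine ComplexConnection.ext (LinearMap.ext fun X => LinearMap.ext fun Z => ?_)
  have hZ : Z = (rePart Z).toC + Complex.I • (imPart Z).toC := ext_re_im (by simp) (by simp)
  rw [hZ, map_add, map_add, map_smul, map_smul, h, h]

lemma complexify_restrict (hD : D.IsReal) : (D.restrict hD).complexify = D :=
  complexConnection_ext_toC fun X Y => by rw [complexify_toC, restrict_nabla_toC]

lemma restrict_complexify (h : C.complexify.IsReal) : C.complexify.restrict h = C := by
  ext X Y : 3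
  apply toC_injective
  rw [restrict_nabla_toC, complexify_toC]

variable [FiniteDimensional ℝ E]

lemma complexify_isFlat_iff : C.complexify.IsFlat ↔ C.IsFlat := by
  refine ⟨fun h X Y Z => ?_, fun h X Y Z => ext_re_im ?_ ?_⟩
  · simpa using congrArg rePart (h X Y Z.toC)
  · simpa using h X Y (rePart Z)
  · simpa using h X Y (imPart Z)

lemma complexify_isTorsionFree_iff : C.complexify.IsTorsionFree ↔ C.IsTorsionFree := by
  refine ⟨fun h X Y => ?_, fun h X Y => ext_re_im ?_ ?_⟩
  · simpa using congrArg rePart (h X Y)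
  · simpa using h X Y
  · simp

end Connections

/-! ### Types of complex vector fields, and d_∇ I against the (0,1)-derivative of T^{1,0} -/

section TypeDecomposition

variable (I : AlmostComplexStructure E M)

@[simp] lemma AlmostComplexStructure.app_apply (X : VField E M) (x : M) :
    I.app X x = I.J x (X x) := rfl

@[simp] lemma AlmostComplexStructure.app_app (X : VField E M) : I.app (I.app X) = -X := by
  ext x; simp [I.sq]

@[simp] lemma AlmostComplexStructure.app_neg (X : VField E M) : I.app (-X) = -I.app X := by
  ext x; simp

@[simp] lemma AlmostComplexStructure.app_add (X Y : VField E M) :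
    I.app (X + Y) = I.app X + I.app Y := by
  ext x; simp

@[simp] lemma AlmostComplexStructure.app_sub (X Y : VField E M) :
    I.app (X - Y) = I.app X - I.app Y := by
  ext x; simp

lemma mem_T10 {x : M} {z : CTangent E x} : z ∈ I.T10 x ↔ imPart z = -I.J x (rePart z) := by
  rw [AlmostComplexStructure.T10, Module.End.mem_eigenspace_iff]
  refine ⟨fun h => ?_, fun h => ext_re_im ?_ ?_⟩
  · have := congrArg rePart h
    simp only [rePart_baseChange, rePart_smul] at this
    simp [this]
  · simp [h]
  · simp [h, I.sq]

lemma mem_map_conjC_T10 {x : M} {z : CTangent E x} :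
    z ∈ (I.T10 x).map (conjC _) ↔ imPart z = I.J x (rePart z) := by
  rw [mem_map_conjC, mem_T10]; simp

lemma isSectionOf_T10_iff {Z : CField E M} :
    IsSectionOf I.T10 Z ↔ imPart Z = -I.app (rePart Z) := by
  refine ⟨fun h => ?_, fun h x => ?_⟩
  · ext x; simpa [mem_T10] using h x
  · simp [mem_T10, h]

/-- The `(1,0)`-vector field `X - iIX`. -/
def AlmostComplexStructure.holo (X : VField E M) : CField E M :=
  X.toC - Complex.I • (I.app X).toC

@[simp] lemma rePart_holo (X : VField E M) : rePart (I.holo X) = X := by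
  simp [AlmostComplexStructure.holo]

@[simp] lemma imPart_holo (X : VField E M) : imPart (I.holo X) = -I.app X := by
  simp [AlmostComplexStructure.holo]

lemma isSectionOf_holo (X : VField E M) : IsSectionOf I.T10 (I.holo X) := by
  simp [isSectionOf_T10_iff]

lemma isCompl_T10 (x : M) : IsCompl (I.T10 x) ((I.T10 x).map (conjC _)) := by
  refine ⟨Submodule.disjoint_def.2 fun z h h' => ?_, codisjoint_iff.2 (eq_top_iff.2 fun z _ => ?_)⟩
  · rw [mem_T10] at h
    rw [mem_map_conjC_T10] at h'
    have h0 : I.J x (rePart z) = 0 := by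
      have h2 : (2 : ℝ) • I.J x (rePart z) = 0 := by
        rw [two_smul]; nth_rewrite 1 [← h']; rw [h]; exact neg_add_cancel _
      exact (smul_eq_zero.1 h2).resolve_left two_ne_zero
    have h1 : rePart z = 0 := by simpa [h0] using (I.sq x (rePart z)).symm
    exact ext_re_im (by simp [h1]) (by simp [h', h0])
  -- The projections to the eigenspaces are (z ∓ iIz)/2; `a` and `b` are their real parts.
  · let a := (2⁻¹ : ℝ) • (rePart z + I.J x (imPart z))
    let b := (2⁻¹ : ℝ) • (rePart z - I.J x (imPart z))
    refine Submodule.mem_sup.2 ⟨(1 : ℂ) ⊗ₜ a - Complex.I ⊗ₜ I.J x a, ?_,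
      (1 : ℂ) ⊗ₜ b + Complex.I ⊗ₜ I.J x b, ?_, ext_re_im ?_ ?_⟩
    · simp [mem_T10]
    · rw [mem_map_conjC_T10]; simp
    · simp only [map_add, map_sub, rePart_tmul, Complex.one_re, Complex.I_re, one_smul, zero_smul,
        sub_zero, add_zero, a, b]
      module
    · simp only [map_add, map_sub, map_smul, imPart_tmul, Complex.one_im, Complex.I_im, one_smul,
        zero_smul, zero_sub, zero_add, a, b, I.sq]
      module

/-- The failure of `D_{X + iIX} (Y - iIY)` to be of type `(1,0)`, where `D` is the complexification
of the connection. -/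
def LinearConnection.dbar (C : LinearConnection E M) (X Y : VField E M) : VField E M :=
  C.nabla (I.app X) Y - C.nabla X (I.app Y) + I.app (C.nabla X Y) +
    I.app (C.nabla (I.app X) (I.app Y))

/-- Every section of T^{1,0} has the form Y - iIY with Y real. A field is of type (1,0) when its
imaginary part plus `I` of its real part is zero, and for D_{X+iIX}(Y-iIY) this sum is `dbar`. -/
lemma preserves_T10_iff (C : LinearConnection E M) :
    (∀ Y Z : CField E M, IsSectionOf I.T10 Y → IsSectionOf I.T10 Z →
      IsSectionOf I.T10 (C.complexify.nablaC (conjC _ Y) Z)) ↔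
      ∀ X Y : VField E M, C.dbar I X Y = 0 := by
  refine ⟨fun h X Y => ?_, fun h Y Z hY hZ => ?_⟩
  · have := h _ _ (isSectionOf_holo I X) (isSectionOf_holo I Y)
    rw [isSectionOf_T10_iff] at this
    rw [← sub_eq_zero] at this
    rw [← this]
    simp [LinearConnection.dbar]
    abel
  · rw [isSectionOf_T10_iff] at hY hZ ⊢
    rw [← sub_eq_zero, ← h (rePart Y) (rePart Z)]
    simp [hY, hZ, LinearConnection.dbar]
    abel

variable [FiniteDimensional ℝ E]

lemma dbar_eq_zero_of_dNabla (C : LinearConnection E M) (ht : C.IsTorsionFree)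
    (h : ∀ X Y, C.dNabla I X Y = 0) (X Y : VField E M) : C.dbar I X Y = 0 := by
  -- Without torsion, d_∇ I = 0 says (∇_X I)Y = (∇_Y I)X.
  have key : ∀ X Y, C.nabla X (I.app Y) - I.app (C.nabla X Y) =
      C.nabla Y (I.app X) - I.app (C.nabla Y X) := fun X Y => by
    have h1 := h X Y
    have h2 := ht X Y
    rw [sub_eq_zero] at h2
    rw [LinearConnection.dNabla, ← h2, I.app_sub] at h1
    rw [← sub_eq_zero, ← h1]; abel
  have h1 := key X Y
  -- The symmetry at (IX, Y), followed by `I`, expresses I(∇_{IX} I)Y through derivatives along Y;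
  -- it then cancels (∇_X I)Y.
  have h2 := congrArg I.app (key (I.app X) Y)
  simp only [I.app_sub, I.app_app, map_neg, I.app_neg] at h2
  rw [LinearConnection.dbar]
  have e : C.nabla X (I.app Y) = C.nabla Y (I.app X) - I.app (C.nabla Y X) + I.app (C.nabla X Y) := by
    rw [← h1]; abel
  have e' : I.app (C.nabla (I.app X) (I.app Y)) =
      -I.app (C.nabla Y X) - -C.nabla Y (I.app X) - C.nabla (I.app X) Y := by
    rw [← h2]; abel
  rw [e, e']; abel

/-- The Nijenhuis tensor of an almost complex structure. -/
def AlmostComplexStructure.nijenhuis (X Y : VField E M) : VField E M :=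
  (I.app X).bracket (I.app Y) - I.app ((I.app X).bracket Y) - I.app (X.bracket (I.app Y)) -
    X.bracket Y

lemma dNabla_eq_zero_of_dbar (C : LinearConnection E M) (ht : C.IsTorsionFree)
    (h : ∀ X Y, C.dbar I X Y = 0) (hN : ∀ X Y, I.nijenhuis X Y = 0) (X Y : VField E M) :
    C.dNabla I X Y = 0 := by
  have ht' : ∀ X Y, X.bracket Y = C.nabla X Y - C.nabla Y X := fun X Y => by
    rw [eq_comm, ← sub_eq_zero]; exact ht X Y
  -- Replacing brackets by commutators of ∇ turns this into formal algebra with I² = -1.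
  have e : C.dbar I X Y - C.dbar I Y X =
      I.app (I.nijenhuis X Y) - (2 : ℝ) • C.dNabla I X Y := by
    simp only [LinearConnection.dbar, AlmostComplexStructure.nijenhuis, LinearConnection.dNabla,
      ht', I.app_sub, I.app_app]
    module
  rw [h, h, hN] at e
  have h0 : I.app (0 : VField E M) = 0 := by ext x; simp
  rw [h0, sub_self, zero_sub, eq_comm, neg_eq_zero, smul_eq_zero] at e
  exact e.resolve_left two_ne_zero

end TypeDecomposition

end ComplexFields

/-! ### Smooth frames -/

section Frames

lemma exists_linearIndependent_span_eq {K V : Type*} [Field K] [AddCommGroup V] [Module K V]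
    (S : Submodule K V) [FiniteDimensional K S] :
    ∃ (r : ℕ) (w : Fin r → V), LinearIndependent K w ∧ Submodule.span K (Set.range w) = S := by
  let b := Module.finBasis K S
  refine ⟨_, fun i => (b i : V), b.linearIndependent.map' S.subtype (Submodule.ker_subtype _), ?_⟩
  rw [Set.range_comp' Subtype.val, ← Submodule.coe_subtype, Submodule.span_image, b.span_eq,
    Submodule.map_subtype_top]

variable {E : Type*} [NormedAddCommGroup E] [NormedSpace ℝ E]
  {M : Type*} [TopologicalSpace M] [ChartedSpace E M] [IsManifold 𝓘(ℝ, E) ∞ M]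

/-- In a trivialization the fields become continuous maps to the model space, where independence of
a finite family is an open condition. -/
lemma eventually_linearIndependent {ι : Type*} [Finite ι] (X : ι → VField E M) (x : M)
    (h : LinearIndependent ℝ fun i => X i x) :
    ∀ᶠ y in 𝓝 x, LinearIndependent ℝ fun i => X i y := by
  let e := trivializationAt E (TangentSpace 𝓘(ℝ, E) : M → Type _) x
  have hx : x ∈ e.baseSet := FiberBundle.mem_baseSet_trivializationAt' x
  let f : M → ι → E := fun y i => (e ⟨y, X i y⟩).2
  have hf : ContinuousAt f x := continuousAt_pi.2 fun i => by
    have := (X i).contMDiff x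
    rw [Bundle.contMDiffAt_section] at this
    exact this.continuousAt
  have key : ∀ y ∈ e.baseSet, LinearIndependent ℝ (f y) ↔ LinearIndependent ℝ fun i => X i y := by
    intro y hy
    rw [← LinearMap.linearIndependent_iff_of_injOn
      (e.continuousLinearEquivAt ℝ y hy).toLinearEquiv.toLinearMap
      (e.continuousLinearEquivAt ℝ y hy).injective.injOn]
    rfl
  filter_upwards [hf.eventually ((key x hx).2 h).eventually, e.open_baseSet.mem_nhds hx] with y hy hy'
  exact (key y hy').1 hy

lemma isSmoothSubbundle_bot :
    IsSmoothSubbundle (fun x : M => (⊥ : Submodule ℂ (CTangent E x))) := fun x =>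
  ⟨0, Fin.elim0, Filter.Eventually.of_forall fun y => ⟨linearIndependent_empty_type, by simp⟩⟩

variable (I : AlmostComplexStructure E M)

/-- `v ↦ v - iIv`. -/
def AlmostComplexStructure.holoAt (x : M) : TangentSpace 𝓘(ℝ, E) x →ₗ[ℝ] CTangent E x where
  toFun v := (1 : ℂ) ⊗ₜ v - Complex.I ⊗ₜ I.J x v
  map_add' v w := by simp [TensorProduct.tmul_add, sub_add_sub_comm]
  map_smul' c v := by simp [smul_sub]

@[simp] lemma rePart_holoAt (x : M) (v : TangentSpace 𝓘(ℝ, E) x) :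
    rePart (I.holoAt x v) = v := by simp [AlmostComplexStructure.holoAt]

@[simp] lemma imPart_holoAt (x : M) (v : TangentSpace 𝓘(ℝ, E) x) :
    imPart (I.holoAt x v) = -I.J x v := by simp [AlmostComplexStructure.holoAt]

lemma holoAt_mem (x : M) (v : TangentSpace 𝓘(ℝ, E) x) : I.holoAt x v ∈ I.T10 x := by
  simp [mem_T10]

lemma holoAt_rePart {x : M} {z : CTangent E x} (hz : z ∈ I.T10 x) :
    I.holoAt x (rePart z) = z := by
  rw [mem_T10] at hz
  exact ext_re_im (by simp) (by simp [hz])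

lemma smul_holoAt (x : M) (c : ℂ) (v : TangentSpace 𝓘(ℝ, E) x) :
    c • I.holoAt x v = I.holoAt x (c.re • v + c.im • I.J x v) :=
  ext_re_im (by simp) (by simp [I.sq])

lemma holoAt_injective (x : M) : Function.Injective (I.holoAt x) := fun v w h => by
  simpa using congrArg rePart h

lemma sum_smul_holoAt {r : ℕ} (x : M) (v : Fin r → TangentSpace 𝓘(ℝ, E) x) (c : Fin r → ℂ) :
    ∑ i, c i • I.holoAt x (v i) =
      I.holoAt x (∑ j : Fin r ⊕ Fin r, Sum.elim (fun i => (c i).re) (fun i => (c i).im) j •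
        Sum.elim v (fun i => I.J x (v i)) j) := by
  simp [smul_holoAt, Finset.sum_add_distrib]

/-- The map v ↦ v - iIv is a complex-linear isomorphism from the tangent space with `I` as
multiplication by i onto T^{1,0}. A coefficient a + ib thus becomes the pair of real coefficients of
v and Iv. -/
lemma linearIndependent_holoAt_iff {r : ℕ} (x : M) (v : Fin r → TangentSpace 𝓘(ℝ, E) x) :
    LinearIndependent ℂ (fun i => I.holoAt x (v i)) ↔
      LinearIndependent ℝ (Sum.elim v fun i => I.J x (v i)) := by
  rw [Fintype.linearIndependent_iff, Fintype.linearIndependent_iff]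
  refine ⟨fun h g hg => ?_, fun h c hc i => ?_⟩
  · have h1 := h (fun i => ⟨g (.inl i), g (.inr i)⟩) (by
      rw [sum_smul_holoAt, ← map_zero (I.holoAt x), ← hg]
      simp)
    rintro (i | i)
    · exact congrArg Complex.re (h1 i)
    · exact congrArg Complex.im (h1 i)
  · rw [sum_smul_holoAt, ← map_zero (I.holoAt x)] at hc
    have := h _ (holoAt_injective I x hc)
    exact Complex.ext (this (.inl i)) (this (.inr i))

lemma span_holoAt_eq_iff {r : ℕ} (x : M) (v : Fin r → TangentSpace 𝓘(ℝ, E) x) :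
    Submodule.span ℂ (Set.range fun i => I.holoAt x (v i)) = I.T10 x ↔
      Submodule.span ℝ (Set.range (Sum.elim v fun i => I.J x (v i))) = ⊤ := by
  refine ⟨fun h => eq_top_iff.2 fun w _ => ?_, fun h => le_antisymm ?_ fun z hz => ?_⟩
  · have := holoAt_mem I x w
    rw [← h, Submodule.mem_span_range_iff_exists_fun] at this
    obtain ⟨c, hc⟩ := this
    rw [sum_smul_holoAt] at hc
    exact (Submodule.mem_span_range_iff_exists_fun ℝ).2 ⟨_, holoAt_injective I x hc⟩
  · rw [Submodule.span_le]
    rintro _ ⟨i, rfl⟩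
    exact holoAt_mem I x _
  · have : rePart z ∈ Submodule.span ℝ (Set.range (Sum.elim v fun i => I.J x (v i))) := by
      rw [h]; trivial
    obtain ⟨g, hg⟩ := (Submodule.mem_span_range_iff_exists_fun ℝ).1 this
    refine (Submodule.mem_span_range_iff_exists_fun ℂ).2
      ⟨fun i => ⟨g (.inl i), g (.inr i)⟩, ?_⟩
    rw [sum_smul_holoAt, ← holoAt_rePart I hz, ← hg]
    simp

lemma sumElim_app_apply {r : ℕ} (X : Fin r → VField E M) (y : M) :
    (fun j => Sum.elim X (fun i => I.app (X i)) j y) =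
      Sum.elim (fun i => X i y) fun i => I.J y (X i y) := by
  ext (i | i) <;> rfl

variable [FiniteDimensional ℝ E] [T2Space M] [SecondCountableTopology M]

/-- A partition of unity glues local sections under a convex constraint that is empty away from `x`.
This supplies global fields for the frames. -/
lemma exists_vField_eq (x : M)
    (v : TangentSpace 𝓘(ℝ, E) x) : ∃ X : VField E M, X x = v := by
  classical
  have : LocallyCompactSpace M := Manifold.locallyCompact_of_finiteDimensional 𝓘(ℝ, E)
  obtain ⟨X, hX⟩ := exists_contMDiffSection_forall_mem_convex_of_local (n := ⊤) 𝓘(ℝ, E)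
    (TangentSpace 𝓘(ℝ, E) : M → Type _) (F_fiber := E) (fun y => {w | ∀ h : y = x, h ▸ w = v})
    (fun y => by
      by_cases h : y = x
      · subst h; simp
      · simpa [h] using convex_univ)
    (fun y => by
      by_cases h : y = x
      · subst h
        obtain ⟨s, hs, hs'⟩ := FiberBundle.exists_contMDiffOn_extend 𝓘(ℝ, E) E (k := ∞) v
        exact ⟨s, hs, _, hs', fun z _ hz => by subst hz; simp⟩
      · refine ⟨{x}ᶜ, isOpen_compl_singleton.mem_nhds h, fun _ => 0, ?_, fun z hz hzx => ?_⟩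
        · exact (0 : VField E M).contMDiff.contMDiffOn
        · exact absurd hzx hz)
  exact ⟨X, hX x rfl⟩

lemma isSmoothSubbundle_top :
    IsSmoothSubbundle (fun x : M => (⊤ : Submodule ℂ (CTangent E x))) := by
  intro x
  have : ∀ y : M, FiniteDimensional ℝ (TangentSpace 𝓘(ℝ, E) y) := fun _ =>
    inferInstanceAs (FiniteDimensional ℝ E)
  let b := Module.finBasis ℝ (TangentSpace 𝓘(ℝ, E) x)
  choose X hX using fun i => exists_vField_eq x (b i)
  refine ⟨_, fun i => (X i).toC, ?_⟩
  filter_upwards [eventually_linearIndependent X x (by simpa [hX] using b.linearIndependent)] with y hy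
  let b' := (basisOfLinearIndependentOfCardEqFinrank' _ hy (by simp; rfl)).baseChange ℂ
  have hb : (fun i => CField.evalAt y (X i).toC) = b' := by
    ext i
    simp [b', toCTangent]
  rw [hb]
  exact ⟨b'.linearIndependent, b'.span_eq⟩

lemma isSmoothSubbundle_T10 : IsSmoothSubbundle I.T10 := by
  intro x
  have : ∀ y : M, FiniteDimensional ℝ (TangentSpace 𝓘(ℝ, E) y) := fun _ =>
    inferInstanceAs (FiniteDimensional ℝ E)
  obtain ⟨r, w, hw, hw'⟩ := exists_linearIndependent_span_eq (I.T10 x)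
  have hwT : ∀ i, w i ∈ I.T10 x := fun i => hw' ▸ Submodule.subset_span ⟨i, rfl⟩
  choose X hX using fun i => exists_vField_eq x (rePart (w i))
  have hwX : w = fun i => I.holoAt x (X i x) := funext fun i => by
    rw [hX, holoAt_rePart I (hwT i)]
  rw [hwX, linearIndependent_holoAt_iff, ← sumElim_app_apply] at hw
  rw [hwX, span_holoAt_eq_iff, ← sumElim_app_apply] at hw'
  -- At `x` the fields X_i and IX_i form a real basis. All tangent spaces have the same dimension,
  -- so near `x` independence alone makes them span.
  have hcard := (Module.finrank_eq_card_basis (Module.Basis.mk hw hw'.ge)).symm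
  refine ⟨_, fun i => I.holo (X i), ?_⟩
  filter_upwards [eventually_linearIndependent _ x hw] with y hy
  have h1 : (fun i => CField.evalAt y (I.holo (X i))) = fun i => I.holoAt y (X i y) :=
    funext fun i => ext_re_im (by simp) (by simp)
  rw [h1, linearIndependent_holoAt_iff, span_holoAt_eq_iff, ← sumElim_app_apply]
  exact ⟨hy, hy.span_eq_top_of_card_eq_finrank' hcard⟩

end Frames

/-! ### Integrability implies the vanishing of the Nijenhuis tensor -/

section Nijenhuis

open VectorField

/-- A constant `J` commutes with the derivative, so the terms cancel in pairs by J² = -1. -/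
lemma lieBracket_nijenhuis {F : Type*} [NormedAddCommGroup F] [NormedSpace ℝ F]
    (J : F →L[ℝ] F) (hJ : ∀ v, J (J v) = -v) {X Y : F → F} {z : F}
    (hX : DifferentiableAt ℝ X z) (hY : DifferentiableAt ℝ Y z) :
    lieBracket ℝ (fun y => J (X y)) (fun y => J (Y y)) z -
      J (lieBracket ℝ (fun y => J (X y)) Y z) - J (lieBracket ℝ X (fun y => J (Y y)) z) -
      lieBracket ℝ X Y z = 0 := by
  have hd : ∀ {W : F → F}, DifferentiableAt ℝ W z → ∀ v,
      fderiv ℝ (fun y => J (W y)) z v = J (fderiv ℝ W z v) := fun hW v => by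
    have := (J.hasFDerivAt.comp z hW.hasFDerivAt).fderiv
    exact congrArg (· v) this
  simp only [lieBracket, hd hX, hd hY, map_sub, hJ]
  abel

variable {E : Type*} [NormedAddCommGroup E] [NormedSpace ℝ E] [FiniteDimensional ℝ E]
  {M : Type*} [TopologicalSpace M] [ChartedSpace E M] [IsManifold 𝓘(ℝ, E) ∞ M]

lemma nijenhuis_eq_zero (I : ComplexStructure E M) (X Y : VField E M) :
    I.toAlmostComplexStructure.nijenhuis X Y = 0 := by
  have : CompleteSpace E := FiniteDimensional.complete ℝ E
  have : IsManifold 𝓘(ℝ, E) (minSmoothness ℝ 3) M := IsManifold.of_le (n := ∞) (by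
    rw [minSmoothness_of_isRCLikeNormedField]; exact WithTop.coe_le_coe.2 le_top)
  have h12 : (1 : WithTop ℕ∞) ≤ ∞ := WithTop.coe_le_coe.2 le_top
  have h22 : (2 : WithTop ℕ∞) ≤ ∞ := WithTop.coe_le_coe.2 le_top
  ext x
  obtain ⟨n, φ, hx, hφ, hφ', hJ⟩ := I.integrable x
  set F := Fin n → ℂ
  let J : F →L[ℝ] F := (Complex.I • ContinuousLinearMap.id ℂ F).restrictScalars ℝ
  have hJJ : ∀ v, J (J v) = -v := fun v => by
    simp [J, smul_smul]
  have hmd : φ.MDifferentiable 𝓘(ℝ, E) 𝓘(ℝ, F) :=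
    ⟨hφ.mdifferentiableOn (by simp), hφ'.mdifferentiableOn (by simp)⟩
  let ψ : F → M := φ.symm
  have hinv : ∀ z ∈ φ.target, (mfderiv 𝓘(ℝ, F) 𝓘(ℝ, E) ψ z).IsInvertible := fun z hz =>
    ⟨hmd.symm.mfderiv hz, rfl⟩
  have hψ : ∀ z ∈ φ.target, ContMDiffAt 𝓘(ℝ, F) 𝓘(ℝ, E) ∞ ψ z := fun z hz =>
    hφ'.contMDiffAt (φ.open_target.mem_nhds hz)
  -- The inverse chart is holomorphic too: apply the injective differential of `φ` to both sides.
  have hinter : ∀ z ∈ φ.target, ∀ v : F, mfderiv 𝓘(ℝ, F) 𝓘(ℝ, E) ψ z (J v) =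
      I.J (ψ z) (mfderiv 𝓘(ℝ, F) 𝓘(ℝ, E) ψ z v) := by
    intro z hz v
    have hy : ψ z ∈ φ.source := φ.map_target hz
    have hBA : ∀ w : F, mvfderiv 𝓘(ℝ, E) φ (ψ z) (mfderiv 𝓘(ℝ, F) 𝓘(ℝ, E) ψ z w) = w := fun w =>
      congrArg (fun f => f w) (hmd.comp_symm_deriv hz)
    refine hmd.mfderiv_injective hy ?_
    exact (hBA (J v)).trans ((hJ _ hy _).trans (congrArg (Complex.I • ·) (hBA v))).symm
  let pb (W : VField E M) : F → F := mpullback 𝓘(ℝ, F) 𝓘(ℝ, E) ψ fun y => W y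
  have hpb : ∀ (W : VField E M), ∀ z ∈ φ.target,
      mfderiv 𝓘(ℝ, F) 𝓘(ℝ, E) ψ z (pb W z) = W (ψ z) := fun W z hz =>
    (hinv z hz).self_apply_inverse _
  have hpbJ : ∀ W : VField E M, ∀ z ∈ φ.target,
      pb (I.toAlmostComplexStructure.app W) z = J (pb W z) := fun W z hz => by
    refine (hinv z hz).injective ((hpb _ z hz).trans ?_)
    exact ((hinter z hz _).trans (congrArg _ (hpb W z hz))).symm
  have hz : φ x ∈ φ.target := φ.map_source hx
  have hmdiff : ∀ W : VField E M, MDifferentiableAt 𝓘(ℝ, E) 𝓘(ℝ, E).tangent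
      (fun y => (⟨y, W y⟩ : TangentBundle 𝓘(ℝ, E) M)) (ψ (φ x)) := fun W => W.mdifferentiableAt
  have hdiff : ∀ W : VField E M, DifferentiableAt ℝ (pb W) (φ x) := fun W => by
    have h := ContMDiffAt.mpullback_vectorField_preimage (m := 1) (n := 2)
      ((W.contMDiff (ψ (φ x))).of_le h12) ((hψ _ hz).of_le h22) (hinv _ hz) (by norm_num)
    exact (contMDiffAt_vectorSpace_iff_contDiffAt.1 h).differentiableAt one_ne_zero
  -- Pullback by a local diffeomorphism respects brackets.
  have hbr : ∀ V W : VField E M, pb (V.bracket W) (φ x) = lieBracket ℝ (pb V) (pb W) (φ x) := by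
    intro V W
    have h := mpullback_mlieBracket (n := 2) (hmdiff V) (hmdiff W) ((hψ _ hz).of_le h22) (by simp)
    rw [← mlieBracketWithin_univ (I := 𝓘(ℝ, F)), mlieBracketWithin_eq_lieBracketWithin] at h
    rw [← lieBracketWithin_univ]
    exact h
  -- The bracket involves derivatives, so equality is needed on a neighbourhood.
  have hpbJ' : ∀ W : VField E M, pb (I.toAlmostComplexStructure.app W) =ᶠ[𝓝 (φ x)]
      fun y => J (pb W y) := fun W => by
    filter_upwards [φ.open_target.mem_nhds hz] with y hy using hpbJ W y hy
  have hsub : ∀ V W : VField E M, pb (V - W) (φ x) = pb V (φ x) - pb W (φ x) := fun V W =>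
    map_sub (mfderiv 𝓘(ℝ, F) 𝓘(ℝ, E) ψ (φ x)).inverse (V (ψ (φ x))) (W (ψ (φ x)))
  have hzero : pb (I.toAlmostComplexStructure.nijenhuis X Y) (φ x) = 0 := by
    rw [AlmostComplexStructure.nijenhuis, hsub, hsub, hsub, hpbJ _ _ hz, hpbJ _ _ hz, hbr, hbr,
      hbr, hbr, (hpbJ' X).lieBracket_vectorField_eq (hpbJ' Y),
      (hpbJ' X).lieBracket_vectorField_eq .rfl,
      Filter.EventuallyEq.lieBracket_vectorField_eq .rfl (hpbJ' Y)]
    exact lieBracket_nijenhuis J hJJ (hdiff X) (hdiff Y)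
  have h := (hpb _ _ hz).symm.trans
    ((congrArg _ hzero).trans (map_zero (mfderiv 𝓘(ℝ, F) 𝓘(ℝ, E) ψ (φ x))))
  have hψx : ψ (φ x) = x := φ.left_inv hx
  rw [hψx] at h
  exact h

end Nijenhuis

/-! ### Special complex structures and tangential variations of Hodge structure -/

section Variations

variable {E : Type*} [NormedAddCommGroup E] [NormedSpace ℝ E]
  {M : Type*} [TopologicalSpace M] [ChartedSpace E M] [IsManifold 𝓘(ℝ, E) ∞ M]

/-- The filtration `T^ℂ M ⊇ T^{1,0} ⊇ 0`. -/
def hodgeFiltration (I : AlmostComplexStructure E M) (k : ℤ) (x : M) : Submodule ℂ (CTangent E x) :=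
  if k ≤ 0 then ⊤ else if k = 1 then I.T10 x else ⊥

section Filtration

variable (I : AlmostComplexStructure E M)

lemma hodgeFiltration_of_nonpos {k : ℤ} (hk : k ≤ 0) : hodgeFiltration I k = fun _ => ⊤ := by
  ext x : 1; simp [hodgeFiltration, hk]

@[simp] lemma hodgeFiltration_one : hodgeFiltration I 1 = I.T10 := by
  ext x : 1; simp [hodgeFiltration]

lemma hodgeFiltration_of_two_le {k : ℤ} (hk : 2 ≤ k) : hodgeFiltration I k = fun _ => ⊥ := by
  ext x : 1
  rw [hodgeFiltration, if_neg (by lia), if_neg (by lia)]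

lemma nonpos_or_eq_one_or_two_le (k : ℤ) : k ≤ 0 ∨ k = 1 ∨ 2 ≤ k := by lia

end Filtration

lemma isSectionOf_bot_iff {Z : CField E M} :
    IsSectionOf (fun _ => ⊥) Z ↔ Z = 0 := by
  refine ⟨fun h => ?_, fun h x => by simp [h]⟩
  have h0 : ∀ x, CField.evalAt x Z = 0 := h
  refine ext_re_im ?_ ?_
  · ext x; simpa using congrArg rePart (h0 x)
  · ext x; simpa using congrArg imPart (h0 x)

variable [FiniteDimensional ℝ E]

/-- The Hodge condition makes `F k` complementary to the conjugate of F^{2-k}, which is everything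
once k ≥ 2. -/
lemma VHS.F_of_two_le (V : VHS E M 1) {k : ℤ} (hk : 2 ≤ k) (x : M) : V.F k x = ⊥ := by
  have h := V.hodge k x
  rw [V.F_nonpos (_ - k + 1) x (by push_cast; lia), map_conjC_top] at h
  exact disjoint_top.1 h.disjoint

lemma VHS.IsTangential.F_eq {V : VHS E M 1} (hV : V.IsTangential) :
    V.F = hodgeFiltration V.I.toAlmostComplexStructure := by
  ext k x : 2
  rcases nonpos_or_eq_one_or_two_le k with hk | rfl | hk
  · rw [hodgeFiltration_of_nonpos _ hk, V.F_nonpos _ _ hk]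
  · rw [hodgeFiltration_one, hV.F_one]
  · rw [hodgeFiltration_of_two_le _ hk, V.F_of_two_le hk]

/-- The special complex structure of a tangential variation of Hodge structure. -/
def VHS.IsTangential.toSpecialComplexStructure {V : VHS E M 1} (hV : V.IsTangential) :
    SpecialComplexStructure E M where
  I := V.I
  conn := V.D.restrict V.real
  flat := by
    rw [← complexify_isFlat_iff, complexify_restrict]
    exact V.flat
  torsionFree := by
    rw [← complexify_isTorsionFree_iff, complexify_restrict]
    exact hV.torsionFree
  dNabla_eq_zero := by
    refine dNabla_eq_zero_of_dbar _ _ ?_ ((preserves_T10_iff _ _).1 ?_) (nijenhuis_eq_zero V.I)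
    · rw [← complexify_isTorsionFree_iff, complexify_restrict]
      exact hV.torsionFree
    · have h := (V.holomorphic 1).2
      rw [show V.F 1 = V.I.T10 from funext hV.F_one] at h
      rwa [complexify_restrict]

variable [T2Space M] [SecondCountableTopology M]

lemma SpecialComplexStructure.isHolomorphicSubbundle_T10 (S : SpecialComplexStructure E M) :
    IsHolomorphicSubbundle S.I.toAlmostComplexStructure S.conn.complexify S.I.T10 :=
  ⟨isSmoothSubbundle_T10 _, (preserves_T10_iff _ _).2
    (dbar_eq_zero_of_dNabla _ _ S.torsionFree S.dNabla_eq_zero)⟩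

/-- The variation of Hodge structure of a special complex structure. -/
def SpecialComplexStructure.toVHS (S : SpecialComplexStructure E M) : VHS E M 1 where
  I := S.I
  D := S.conn.complexify
  flat := (complexify_isFlat_iff _).2 S.flat
  real := complexify_isReal _
  F := hodgeFiltration S.I.toAlmostComplexStructure
  antitone k l x hkl := by
    rcases nonpos_or_eq_one_or_two_le k with hk | rfl | hk
    · simp [hodgeFiltration_of_nonpos _ hk]
    · rcases nonpos_or_eq_one_or_two_le l with hl | rfl | hl
      · lia
      · exact le_rfl
      · simp [hodgeFiltration_of_two_le _ hl]
    · simp [hodgeFiltration_of_two_le _ (hk.trans hkl)]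
  F_nonpos k x hk := by simp [hodgeFiltration_of_nonpos _ hk]
  holomorphic k := by
    rcases nonpos_or_eq_one_or_two_le k with hk | rfl | hk
    · rw [hodgeFiltration_of_nonpos _ hk]
      exact ⟨isSmoothSubbundle_top, fun _ _ _ _ _ => trivial⟩
    · rw [hodgeFiltration_one]
      exact S.isHolomorphicSubbundle_T10
    · rw [hodgeFiltration_of_two_le _ hk]
      refine ⟨isSmoothSubbundle_bot, fun Y Z _ hZ => ?_⟩
      rw [isSectionOf_bot_iff] at hZ ⊢
      simp [hZ]
  transversal k X Z hZ := by
    -- Either the section is zero, or the target F^{k-1} is the whole bundle.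
    rcases le_or_gt 2 k with hk | hk
    · rw [hodgeFiltration_of_two_le _ hk, isSectionOf_bot_iff] at hZ
      intro x
      simp [hZ]
    · rw [hodgeFiltration_of_nonpos _ (by lia)]
      exact fun _ => trivial
  hodge k x := by
    -- The indices k and 2 - k are paired: the top step meets the zero step, and T^{1,0} meets its
    -- own conjugate.
    rcases nonpos_or_eq_one_or_two_le k with hk | rfl | hk
    · rw [hodgeFiltration_of_nonpos _ hk, hodgeFiltration_of_two_le _ (by push_cast; lia)]
      simpa using isCompl_top_bot
    · simpa using isCompl_T10 S.I.toAlmostComplexStructure x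
    · rw [hodgeFiltration_of_two_le _ hk, hodgeFiltration_of_nonpos _ (by push_cast; lia),
        map_conjC_top]
      exact isCompl_bot_top

lemma SpecialComplexStructure.toVHS_isTangential (S : SpecialComplexStructure E M) :
    S.toVHS.IsTangential where
  torsionFree := (complexify_isTorsionFree_iff _).2 S.torsionFree
  F_one x := by simp [SpecialComplexStructure.toVHS]

/-- Special complex structures on `M` are the same as tangential variations of Hodge structure of
weight one. -/
def specialComplexEquiv : SpecialComplexStructure E M ≃ TangentVHS E M where
  toFun S := ⟨S.toVHS, S.toVHS_isTangential⟩
  invFun V := V.2.toSpecialComplexStructure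
  left_inv S := SpecialComplexStructure.ext rfl (restrict_complexify _ S.toVHS.real)
  right_inv V := Subtype.ext (VHS.ext rfl (complexify_restrict _ V.1.real) V.2.F_eq.symm)

end Variations

/-! ### Special Kähler structures and polarizations -/

section Polarizations

variable {E : Type*} [NormedAddCommGroup E] [NormedSpace ℝ E]
  {M : Type*} [TopologicalSpace M] [ChartedSpace E M]

lemma eq_toCTangent_add {x : M} (z : CTangent E x) :
    z = toCTangent (rePart z) + Complex.I • toCTangent (imPart z) :=
  ext_re_im (by simp) (by simp)

lemma bilinear_ext_toCTangent {x : M} {Q Q' : CTangent E x →ₗ[ℂ] CTangent E x →ₗ[ℂ] ℂ}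
    (h : ∀ u v : TangentSpace 𝓘(ℝ, E) x,
      Q (toCTangent u) (toCTangent v) = Q' (toCTangent u) (toCTangent v)) : Q = Q' := by
  refine LinearMap.ext fun z => LinearMap.ext fun w => ?_
  rw [eq_toCTangent_add z, eq_toCTangent_add w]
  simp [h]

lemma contMDiff_complex_of_re_im {g : M → ℂ}
    (hr : ContMDiff 𝓘(ℝ, E) 𝓘(ℝ, ℝ) ∞ fun x => (g x).re)
    (hi : ContMDiff 𝓘(ℝ, E) 𝓘(ℝ, ℝ) ∞ fun x => (g x).im) :
    ContMDiff 𝓘(ℝ, E) 𝓘(ℝ, ℂ) ∞ g :=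
  (Complex.equivRealProdCLM.symm : ℝ × ℝ →L[ℝ] ℂ).contMDiff.comp (hr.prodMk_space hi)

variable [IsManifold 𝓘(ℝ, E) ∞ M]

/-! ### Directional derivatives of functions -/

section DirDeriv

variable {G G' : Type*} [NormedAddCommGroup G] [NormedSpace ℝ G]
  [NormedAddCommGroup G'] [NormedSpace ℝ G']

lemma dirDeriv_clm_comp (L : G →L[ℝ] G') (X : VField E M) {g : M → G} {x : M}
    (hg : MDifferentiableAt 𝓘(ℝ, E) 𝓘(ℝ, G) g x) :
    dirDeriv X (fun y => L (g y)) x = L (dirDeriv X g x) := by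
  have h := mfderiv_comp x (L.mdifferentiableAt (x := g x)) hg
  rw [ContinuousLinearMap.mfderiv_eq] at h
  exact congrArg (fun f => f (X x)) h

lemma dirDeriv_add (X : VField E M) {g g' : M → G} {x : M}
    (hg : MDifferentiableAt 𝓘(ℝ, E) 𝓘(ℝ, G) g x) (hg' : MDifferentiableAt 𝓘(ℝ, E) 𝓘(ℝ, G) g' x) :
    dirDeriv X (fun y => g y + g' y) x = dirDeriv X g x + dirDeriv X g' x := by
  simp [dirDeriv, mvfderiv_fun_add hg hg']

lemma dirDeriv_neg (X : VField E M) (g : M → G) (x : M) :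
    dirDeriv X (fun y => -g y) x = -dirDeriv X g x := by
  simp [dirDeriv, mvfderiv_fun_neg]

lemma dirDeriv_sub (X : VField E M) {g g' : M → G} {x : M}
    (hg : MDifferentiableAt 𝓘(ℝ, E) 𝓘(ℝ, G) g x) (hg' : MDifferentiableAt 𝓘(ℝ, E) 𝓘(ℝ, G) g' x) :
    dirDeriv X (fun y => g y - g' y) x = dirDeriv X g x - dirDeriv X g' x := by
  simp [dirDeriv, mvfderiv_fun_sub hg hg']

lemma dirDeriv_re (X : VField E M) {g : M → ℂ} (hg : ContMDiff 𝓘(ℝ, E) 𝓘(ℝ, ℂ) ∞ g) (x : M) :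
    (dirDeriv X g x).re = dirDeriv X (fun y => (g y).re) x :=
  (dirDeriv_clm_comp Complex.reCLM X (hg.mdifferentiable (by simp) x)).symm

lemma dirDeriv_im (X : VField E M) {g : M → ℂ} (hg : ContMDiff 𝓘(ℝ, E) 𝓘(ℝ, ℂ) ∞ g) (x : M) :
    (dirDeriv X g x).im = dirDeriv X (fun y => (g y).im) x :=
  (dirDeriv_clm_comp Complex.imCLM X (hg.mdifferentiable (by simp) x)).symm

end DirDeriv

/-! ### Two-forms and their complex-bilinear extensions -/

section TwoForms

variable (Ω : TwoForm E M)

lemma TwoForm.swap (x : M) (u v : TangentSpace 𝓘(ℝ, E) x) : Ω.form x u v = -Ω.form x v u := by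
  have h := Ω.alt x (u + v)
  simp only [map_add, LinearMap.add_apply, Ω.alt] at h
  linarith

lemma TwoForm.mdifferentiableAt_app (X Y : VField E M) (x : M) :
    MDifferentiableAt 𝓘(ℝ, E) 𝓘(ℝ, ℝ) (Ω.app X Y) x :=
  (Ω.smooth X Y).mdifferentiable (by simp) x

/-- The complex-bilinear extension of `-Ω`. -/
def TwoForm.polarization (x : M) : CTangent E x →ₗ[ℂ] CTangent E x →ₗ[ℂ] ℂ :=
  LinearMap.mk₂ ℂ
    (fun z w =>
      ⟨Ω.form x (imPart z) (imPart w) - Ω.form x (rePart z) (rePart w),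
        -(Ω.form x (rePart z) (imPart w) + Ω.form x (imPart z) (rePart w))⟩)
    (fun z z' w => by apply Complex.ext <;> simp <;> ring)
    (fun c z w => by apply Complex.ext <;> simp <;> ring)
    (fun z w w' => by apply Complex.ext <;> simp <;> ring)
    (fun c z w => by apply Complex.ext <;> simp <;> ring)

@[simp] lemma TwoForm.polarization_re (x : M) (z w : CTangent E x) :
    (Ω.polarization x z w).re =
      Ω.form x (imPart z) (imPart w) - Ω.form x (rePart z) (rePart w) := rfl

@[simp] lemma TwoForm.polarization_im (x : M) (z w : CTangent E x) :
    (Ω.polarization x z w).im =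
      -(Ω.form x (rePart z) (imPart w) + Ω.form x (imPart z) (rePart w)) := rfl

lemma TwoForm.polarization_toCTangent (x : M) (u v : TangentSpace 𝓘(ℝ, E) x) :
    Ω.polarization x (toCTangent u) (toCTangent v) = ((-(Ω.form x u v) : ℝ) : ℂ) := by
  apply Complex.ext <;> simp

lemma TwoForm.contMDiff_polarization (Z W : CField E M) : ContMDiff 𝓘(ℝ, E) 𝓘(ℝ, ℂ) ∞
    (fun x => Ω.polarization x (CField.evalAt x Z) (CField.evalAt x W)) := by
  refine contMDiff_complex_of_re_im ?_ ?_
  · simpa using (Ω.smooth (imPart Z) (imPart W)).sub (Ω.smooth (rePart Z) (rePart W))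
  · simpa using ((Ω.smooth (rePart Z) (imPart W)).add (Ω.smooth (imPart Z) (rePart W))).neg

/-- One direction expands Q into its four real terms and applies the real product rule to each; the
other tests the identity on real fields. -/
lemma TwoForm.isParallel_iff (C : LinearConnection E M) :
    Ω.IsParallel C ↔ ∀ (X : VField E M) (Z W : CField E M) (x : M),
      dirDeriv X (fun y => Ω.polarization y (CField.evalAt y Z) (CField.evalAt y W)) x =
        Ω.polarization x (CField.evalAt x (C.complexify.nabla X Z)) (CField.evalAt x W) +
          Ω.polarization x (CField.evalAt x Z) (CField.evalAt x (C.complexify.nabla X W)) := by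
  refine ⟨fun h X Z W x => ?_, fun h X Y Z x => ?_⟩
  · have h' : ∀ Y Z : VField E M, dirDeriv X (Ω.app Y Z) x =
        Ω.form x (C.nabla X Y x) (Z x) + Ω.form x (Y x) (C.nabla X Z x) := fun Y Z => by
      have := h X Y Z x
      change dirDeriv X (Ω.app Y Z) x - Ω.form x (C.nabla X Y x) (Z x) -
        Ω.form x (Y x) (C.nabla X Z x) = 0 at this
      linarith
    have hd := Ω.mdifferentiableAt_app
    apply Complex.ext
    · rw [dirDeriv_re X (Ω.contMDiff_polarization Z W)]
      have := dirDeriv_sub X (hd (imPart Z) (imPart W) x) (hd (rePart Z) (rePart W) x)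
      rw [h', h'] at this
      simp only [TwoForm.polarization_re, rePart_evalAt, imPart_evalAt, Complex.add_re,
        rePart_complexify, imPart_complexify]
      refine this.trans ?_
      ring
    · rw [dirDeriv_im X (Ω.contMDiff_polarization Z W)]
      have := dirDeriv_add X (hd (rePart Z) (imPart W) x) (hd (imPart Z) (rePart W) x)
      rw [h', h'] at this
      simp only [TwoForm.polarization_im, rePart_evalAt, imPart_evalAt, Complex.add_im,
        rePart_complexify, imPart_complexify, dirDeriv_neg]
      refine (congrArg Neg.neg this).trans ?_
      ring
  · have h1 := congrArg Complex.re (h X Y.toC Z.toC x)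
    rw [dirDeriv_re X (Ω.contMDiff_polarization _ _)] at h1
    simp only [TwoForm.polarization_re, rePart_evalAt, imPart_evalAt, Complex.add_re,
        rePart_complexify, imPart_complexify, rePart_toC, imPart_toC, VField.zero_apply, map_zero,
        zero_sub, dirDeriv_neg] at h1
    change dirDeriv X (fun y => Ω.form y (Y y) (Z y)) x - Ω.form x (C.nabla X Y x) (Z x) -
      Ω.form x (Y x) (C.nabla X Z x) = 0
    linarith

/-- For a torsion-free connection dΩ is the alternating sum of the covariant derivatives of Ω. -/
lemma TwoForm.IsParallel.isClosed [FiniteDimensional ℝ E] {Ω : TwoForm E M}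
    {C : LinearConnection E M} (h : Ω.IsParallel C) (ht : C.IsTorsionFree) : Ω.IsClosed := by
  intro X Y Z x
  have ht' : ∀ X Y : VField E M, X.bracket Y = C.nabla X Y - C.nabla Y X := fun X Y => by
    rw [eq_comm, ← sub_eq_zero]; exact ht X Y
  have h1 := h X Y Z x
  have h2 := h Y X Z x
  have h3 := h Z X Y x
  simp only [ht', TwoForm.app, VField.sub_apply, map_sub, LinearMap.sub_apply] at h1 h2 h3 ⊢
  have s := Ω.swap x
  linarith [s (Y x) (C.nabla X Z x), s (X x) (C.nabla Y Z x), s (X x) (C.nabla Z Y x)]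

lemma isKahler_invariant_right {Ω : TwoForm E M} {I : AlmostComplexStructure E M}
    (h : ∀ (x : M) (u v : TangentSpace 𝓘(ℝ, E) x), Ω.form x (I.J x u) (I.J x v) = Ω.form x u v)
    (x : M) (u v : TangentSpace 𝓘(ℝ, E) x) : Ω.form x (I.J x u) v = -Ω.form x u (I.J x v) := by
  rw [← h x u (I.J x v), I.sq, map_neg, neg_neg]

end TwoForms

/-! ### Hodge pieces, positivity and the Kähler condition -/

section Hodge

variable [FiniteDimensional ℝ E]

lemma VHS.IsTangential.mem_piece_one {V : VHS E M 1} (hV : V.IsTangential) {x : M}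
    {z : CTangent E x} : z ∈ V.piece 1 x ↔ z ∈ V.I.T10 x := by
  rw [VHS.piece, V.F_nonpos (_ - 1) x (by simp), map_conjC_top, inf_top_eq, hV.F_one]

lemma VHS.IsTangential.mem_piece_zero {V : VHS E M 1} (hV : V.IsTangential) {x : M}
    {z : CTangent E x} : z ∈ V.piece 0 x ↔ z ∈ (V.I.T10 x).map (conjC _) := by
  rw [VHS.piece, V.F_nonpos 0 x le_rfl, top_inf_eq, Nat.cast_one, sub_zero, hV.F_one]

lemma VHS.piece_eq_bot (V : VHS E M 1) {k : ℤ} (h0 : k ≠ 0) (h1 : k ≠ 1) (x : M) :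
    V.piece k x = ⊥ := by
  rcases nonpos_or_eq_one_or_two_le k with hk | hk | hk
  · rw [VHS.piece, V.F_of_two_le (k := _ - k) (by push_cast; lia), Submodule.map_bot, inf_bot_eq]
  · exact absurd hk h1
  · rw [VHS.piece, V.F_of_two_le hk, bot_inf_eq]

/-- Only k = 0, 1 give nonzero pieces, so two equal types remain. There the real part of Q is Ω(Iu,
Iv) - Ω(u, v) and the imaginary part is ±(Ω(u, Iv) + Ω(Iu, v)); both vanish by invariance. -/
lemma polarization_orth {V : VHS E M 1} (hV : V.IsTangential) {Ω : TwoForm E M}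
    (h : Ω.IsKahler V.I.toAlmostComplexStructure) (k l : ℤ) (x : M) (hkl : k + l ≠ (1 : ℕ))
    (z : CTangent E x) (hz : z ∈ V.piece k x) (w : CTangent E x) (hw : w ∈ V.piece l x) :
    Ω.polarization x z w = 0 := by
  have hr := isKahler_invariant_right h.invariant x
  by_cases hk : k = 0 ∨ k = 1
  swap
  · rw [not_or] at hk
    rw [V.piece_eq_bot hk.1 hk.2, Submodule.mem_bot] at hz
    simp [hz]
  by_cases hl : l = 0 ∨ l = 1
  swap
  · rw [not_or] at hl
    rw [V.piece_eq_bot hl.1 hl.2, Submodule.mem_bot] at hw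
    simp [hw]
  rcases hk with rfl | rfl <;> rcases hl with rfl | rfl
  · rw [hV.mem_piece_zero, mem_map_conjC_T10] at hz hw
    apply Complex.ext <;> simp [hz, hw, hr, V.I.sq]
  · simp at hkl
  · simp at hkl
  · rw [hV.mem_piece_one, mem_T10] at hz hw
    apply Complex.ext <;> simp [hz, hw, hr, V.I.sq]

lemma polarization_pos {V : VHS E M 1} (hV : V.IsTangential) {Ω : TwoForm E M}
    (h : Ω.IsKahler V.I.toAlmostComplexStructure) (k : ℤ) (x : M)
    (z : CTangent E x) (hz : z ∈ V.piece k x) (hz0 : z ≠ 0) :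
    ∃ r : ℝ, 0 < r ∧
      Complex.I ^ (k - ((1 : ℕ) - k)) * Ω.polarization x z (conjC _ z) = r := by
  have hr := isKahler_invariant_right h.invariant x
  by_cases hk : k = 0 ∨ k = 1
  swap
  · rw [not_or] at hk
    rw [V.piece_eq_bot hk.1 hk.2, Submodule.mem_bot] at hz
    exact absurd hz hz0
  -- With u the real part of z = u ∓ iIu, the Hermitian form is 2g(u, u). The powers i^{±1} absorb
  -- the sign that distinguishes the two types.
  refine ⟨2 * Ω.form x (rePart z) (V.I.J x (rePart z)), ?_, ?_⟩
  · refine mul_pos two_pos (h.pos x _ fun h0 => hz0 (ext_re_im (by simpa using h0) ?_))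
    rcases hk with rfl | rfl
    · rw [hV.mem_piece_zero, mem_map_conjC_T10] at hz
      simp [hz, h0]
    · rw [hV.mem_piece_one, mem_T10] at hz
      simp [hz, h0]
  · rcases hk with rfl | rfl
    · rw [hV.mem_piece_zero, mem_map_conjC_T10] at hz
      apply Complex.ext <;> simp [hz, hr, Ω.alt, V.I.sq, two_mul]
    · rw [hV.mem_piece_one, mem_T10] at hz
      apply Complex.ext <;> simp [hz, hr, Ω.alt, V.I.sq, two_mul]

/-- Minus the restriction of a polarization to `TM`. -/
def VPHS.toTwoForm (V : VPHS E M 1) : TwoForm E M where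
  form x := LinearMap.mk₂ ℝ (fun u v => -(V.Q x (toCTangent u) (toCTangent v)).re)
    (fun u u' v => by simp [toCTangent, TensorProduct.tmul_add]; ring)
    (fun c u v => by simp [toCTangent])
    (fun u v v' => by simp [toCTangent, TensorProduct.tmul_add]; ring)
    (fun c u v => by simp [toCTangent])
  alt x v := by
    have := congrArg Complex.re (V.Q_symm x (toCTangent v) (toCTangent v))
    simp at this
    simp
    linarith
  smooth X Y := by
    have := (Complex.reCLM.contMDiff.comp (V.Q_smooth X.toC Y.toC)).neg
    simpa using this

lemma VPHS.toTwoForm_form (V : VPHS E M 1) (x : M) (u v : TangentSpace 𝓘(ℝ, E) x) :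
    V.toTwoForm.form x u v = -(V.Q x (toCTangent u) (toCTangent v)).re := rfl

/-- Q is determined by its values on real vectors, and these are real by `Q_real`. -/
lemma VPHS.polarization_toTwoForm (V : VPHS E M 1) : V.toTwoForm.polarization = V.Q := by
  ext x : 1
  refine bilinear_ext_toCTangent fun u v => ?_
  rw [TwoForm.polarization_toCTangent, V.toTwoForm_form, neg_neg]
  exact Complex.ext rfl (V.Q_real x u v).symm

lemma VPHS.toTwoForm_isParallel (V : VPHS E M 1) :
    V.toTwoForm.IsParallel (V.D.restrict V.real) := by
  rw [TwoForm.isParallel_iff, complexify_restrict, V.polarization_toTwoForm]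
  exact V.Q_flat

lemma VPHS.toTwoForm_isKahler (V : VPHS E M 1) (hV : V.IsTangential) :
    V.toTwoForm.IsKahler V.I.toAlmostComplexStructure where
  closed := V.toTwoForm_isParallel.isClosed
    ((complexify_isTorsionFree_iff _).1 (by rw [complexify_restrict]; exact hV.torsionFree))
  invariant x u v := by
    -- The real part of Q(u - iIu, v - iIv) is Ω(Iu, Iv) - Ω(u, v).
    have h := congrArg Complex.re (V.Q_orth 1 1 x (by simp)
      _ (hV.mem_piece_one.2 (holoAt_mem _ x u)) _ (hV.mem_piece_one.2 (holoAt_mem _ x v)))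
    rw [← V.polarization_toTwoForm] at h
    simpa [sub_eq_zero] using h
  pos x u hu := by
    -- For z = u - iIu the positive number `r` is 2Ω(u, Iu).
    obtain ⟨r, hr, h⟩ := V.Q_pos 1 x _ (hV.mem_piece_one.2 (holoAt_mem _ x u)) fun h0 =>
      hu (by simpa using congrArg rePart h0)
    have h' := congrArg Complex.re h
    rw [← V.polarization_toTwoForm] at h'
    simp at h'
    rw [V.toTwoForm.swap x (V.I.J x u) u] at h'
    linarith

variable [T2Space M] [SecondCountableTopology M]

/-- The polarized variation of Hodge structure of a special Kähler structure. -/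
def SpecialKahlerStructure.toVPHS (S : SpecialKahlerStructure E M) : VPHS E M 1 where
  toVHS := S.toSpecialComplexStructure.toVHS
  Q := S.Ω.polarization
  Q_smooth := S.Ω.contMDiff_polarization
  Q_symm x z w := by
    have s := S.Ω.swap x
    apply Complex.ext
    · simp [s (imPart w) (imPart z), s (rePart w) (rePart z)]; ring
    · simp [s (imPart w) (rePart z), s (rePart w) (imPart z)]
  Q_real x u v := by simp
  Q_flat := (S.Ω.isParallel_iff S.conn).1 S.parallel
  Q_orth := polarization_orth S.toSpecialComplexStructure.toVHS_isTangential S.kahler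
  Q_pos := polarization_pos S.toSpecialComplexStructure.toVHS_isTangential S.kahler

/-- The special Kähler structure of a tangential variation of polarized Hodge structures. -/
def VPHS.toSpecialKahlerStructure (V : VPHS E M 1) (hV : V.IsTangential) :
    SpecialKahlerStructure E M where
  toSpecialComplexStructure := hV.toSpecialComplexStructure
  Ω := V.toTwoForm
  kahler := V.toTwoForm_isKahler hV
  parallel := V.toTwoForm_isParallel

/-- Special Kähler structures on `M` are the same as tangential variations of polarized Hodge
structures of weight one. -/
def specialKahlerEquiv : SpecialKahlerStructure E M ≃ TangentVPHS E M where
  toFun S := ⟨S.toVPHS, S.toSpecialComplexStructure.toVHS_isTangential⟩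
  invFun V := V.1.toSpecialKahlerStructure V.2
  left_inv S := by
    refine SpecialKahlerStructure.ext rfl
      (restrict_complexify _ S.toSpecialComplexStructure.toVHS.real) (TwoForm.ext ?_)
    funext x
    refine LinearMap.ext₂ fun u v => ?_
    change -(S.Ω.polarization x (toCTangent u) (toCTangent v)).re = S.Ω.form x u v
    simp
  right_inv V := Subtype.ext (VPHS.ext rfl (complexify_restrict _ V.1.real) V.2.F_eq.symm
    V.1.polarization_toTwoForm)

end Hodge

end Polarizations

end SpecialGeometry

end

theorem mainTheorem3
    (E : Type*) [NormedAddCommGroup E] [NormedSpace ℝ E] [FiniteDimensional ℝ E]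
    (M : Type*) [TopologicalSpace M] [T2Space M] [SecondCountableTopology M]
    [ChartedSpace E M] [IsManifold 𝓘(ℝ, E) ∞ M] :
    ∃ Φ : SpecialGeometry.SpecialComplexStructure E M ≃ SpecialGeometry.TangentVHS E M,
      (∀ S : SpecialGeometry.SpecialComplexStructure E M,
        (Φ S).1.I = S.I ∧
        (∀ X Y : SpecialGeometry.VField E M,
          (Φ S).1.D.nabla X Y.toC = (S.conn.nabla X Y).toC) ∧
        (∀ x : M, (Φ S).1.F 1 x = S.I.T10 x) ∧
        SpecialGeometry.IsHolomorphicSubbundle S.I.toAlmostComplexStructure (Φ S).1.D S.I.T10) ∧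
      ∃ Ψ : SpecialGeometry.SpecialKahlerStructure E M ≃ SpecialGeometry.TangentVPHS E M,
        ∀ S : SpecialGeometry.SpecialKahlerStructure E M,
          (Ψ S).toTangentVHS = Φ S.toSpecialComplexStructure ∧
          ∀ (x : M) (u v : TangentSpace 𝓘(ℝ, E) x),
            (Ψ S).1.Q x (SpecialGeometry.toCTangent u) (SpecialGeometry.toCTangent v) =
              ((-(S.Ω.form x u v) : ℝ) : ℂ) := by
  -- Both equivalences build the variation from (I, ∇) in the same way, so forgetting the
  -- polarization is compatible by definition.
  refine ⟨SpecialGeometry.specialComplexEquiv, fun S => ⟨rfl, fun X Y => ?_, fun x => ?_, ?_⟩,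
    SpecialGeometry.specialKahlerEquiv, fun S => ⟨rfl, fun x u v => ?_⟩⟩
  · exact SpecialGeometry.complexify_toC S.conn X Y
  · exact S.toVHS_isTangential.F_one x
  · exact S.isHolomorphicSubbundle_T10
  · exact S.Ω.polarization_toCTangent x u v
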